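/- Let $R$ be a linearly ordered field and $n\ge 0$. A \emph{polytope} in $R^n$ is a bounded intersection of finitely many halfspaces $\{x : \langle\alpha,x\rangle\ge\beta\}$ (possibly empty). A \emph{face} of a polytope $P$ is either $\emptyset$ or the set of points of $P$ minimizing some linear function $x\mapsto\langle c,x\rangle$ over $P$; the faces of $P$, ordered by inclusion, form the \emph{face lattice} of $P$, with least element $\emptyset$ and greatest element $P$. Write $\dim\emptyset=0$ and, for a nonempty polytope $P$, let $\dim P$ be one plus the dimension of the direction space of the affine hull of $P$ (so dimensions are shifted by one). The rank of a face is its dimension in this sense. Let $P\subset R^n$ be a polytope. (i) For every face $Q$ of $P$ there is a polytope $P'\subset R^n$ such that the interval $[Q,P]$ of the face lattice of $P$ (the faces $F$ of $P$ with $Q\subseteq F\subseteq P$) is order-isomorphic to the face lattice of $P'$, and $\dim P=\dim P'+\operatorname{rank} Q$. (ii) More generally, for all faces $Q\subseteq Q'$ of $P$ there is a polytope $P'\subset R^n$ such that the interval $[Q,Q']$ of the face lattice of $P$ is order-isomorphic to the face lattice of $P'$, and $\operatorname{rank} Q'=\dim P'+\operatorname{rank} Q$. -/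

import Mathlib

namespace PolyhedralFaces

variable {R : Type*} [Field R] [LinearOrder R] {n : ℕ}

/-- A polyhedron of `R^n`: the intersection of finitely many halfspaces `⟨α, x⟩ ≥ β`,
where each pair `e = (α, β)` of the finite set `base` represents one halfspace. -/
def IsPolyhedron (P : Set (Fin n → R)) : Prop :=
  ∃ base : Finset ((Fin n → R) × R), P = {x | ∀ e ∈ base, e.2 ≤ e.1 ⬝ᵥ x}

/-- A polytope (compact polyhedron): a polyhedron that is a bounded set. -/
def IsPolytope (P : Set (Fin n → R)) : Prop :=
  IsPolyhedron P ∧ ∃ M : R, ∀ x ∈ P, ∀ i, |x i| ≤ M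

/-- The set of points of `P` minimizing the linear function `x ↦ ⟨c, x⟩` over `P`. -/
def argmin (P : Set (Fin n → R)) (c : Fin n → R) : Set (Fin n → R) :=
  {x | x ∈ P ∧ ∀ y ∈ P, c ⬝ᵥ x ≤ c ⬝ᵥ y}

/-- `F` is a face of `P`: it is empty, or the set of minimizers over `P` of a linear function. -/
def IsFace (P F : Set (Fin n → R)) : Prop :=
  F = ∅ ∨ ∃ c : Fin n → R, F = argmin P c

/-- The face lattice of `P`: the faces of `P`, ordered by inclusion. -/
abbrev FaceLattice (P : Set (Fin n → R)) : Type _ := {F : Set (Fin n → R) // IsFace P F}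

theorem isFace_self (P : Set (Fin n → R)) : IsFace P P :=
  Or.inr ⟨0, by simp [argmin]⟩

theorem IsFace.subset {P F : Set (Fin n → R)} (h : IsFace P F) : F ⊆ P := by
  rcases h with rfl | ⟨c, rfl⟩
  · exact Set.empty_subset P
  · exact fun _ hx => hx.1

/-- The greatest face of `P` is `P` and the least face is the empty set. -/
instance (P : Set (Fin n → R)) : BoundedOrder (FaceLattice P) where
  top := ⟨P, isFace_self P⟩
  le_top F := F.2.subset
  bot := ⟨∅, Or.inl rfl⟩
  bot_le F := Set.empty_subset F.1

open Classical in
/-- The dimension of `P`, shifted by one so that it takes values in `ℕ`: it is `0` for the empty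
set, and one plus the dimension of the direction of the affine hull otherwise. -/
noncomputable def polyDim (P : Set (Fin n → R)) : ℕ :=
  if P = ∅ then 0 else Module.finrank R (affineSpan R P).direction + 1

/-- The rank function of the face lattice: the (shifted) dimension of the face. -/
noncomputable def FaceLattice.rank {P : Set (Fin n → R)} (F : FaceLattice P) : ℕ :=
  polyDim F.1

end PolyhedralFaces

/-! If `Q` is nonempty, take a relative interior point `x₀` of `Q`, one where only inequalities
tight on all of `Q` are tight (`exists_mem_forall_tight`). Faces containing `Q` are then the faces
through `x₀`. Let `a` collect the linear parts of the inequalities tight at `x₀`. Near `x₀`, `P`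
looks like the cone `0 ≤ a v`, whose lineality space `ker a` is the direction of `Q`. Slicing a
complement of `ker a` by `∑ j, a v j = 1` gives a polytope, the vertex figure when `Q` is a vertex;
it serves as `P'`.

Nonempty faces on both sides are given by sets of tight inequalities
(`exists_argmin_eq_setOf_tight`, `isFace_setOf_tight`), which matches them; `Q` itself matches the
empty face. Rank-nullity for `a` gives the dimension formula. Part (ii) is (i) applied to `Q'`,
since faces of `Q'` are the faces of `P` inside `Q'`. -/

namespace PolyhedralFaces

variable {R : Type*} [Field R] [LinearOrder R] {n : ℕ}

/-! ### Faces as sets of tight inequalities -/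

section OrderedField

variable [IsStrictOrderedRing R]

/-- From a point satisfying finitely many inequalities one may move a little in any direction
that does not violate the inequalities that are tight at the point. -/
theorem exists_pos_add_smul_mem (base : Finset ((Fin n → R) × R)) (x v : Fin n → R)
    (hx : ∀ e ∈ base, e.2 ≤ e.1 ⬝ᵥ x)
    (hv : ∀ e ∈ base, e.1 ⬝ᵥ x = e.2 → 0 ≤ e.1 ⬝ᵥ v) :
    ∃ t : R, 0 < t ∧ ∀ e ∈ base, e.2 ≤ e.1 ⬝ᵥ (x + t • v) := by
  classical
  -- Validity for all smaller steps lets the induction combine two bounds by `min`.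
  suffices h : ∃ t : R, 0 < t ∧ ∀ s : R, 0 < s → s ≤ t →
      ∀ e ∈ base, e.2 ≤ e.1 ⬝ᵥ (x + s • v) by
    obtain ⟨t, ht, h⟩ := h
    exact ⟨t, ht, h t ht le_rfl⟩
  induction base using Finset.induction_on with
  | empty => exact ⟨1, one_pos, by simp⟩
  | insert e B _ ih =>
    obtain ⟨t, ht, hB⟩ := ih (fun e he => hx e (Finset.mem_insert_of_mem he))
      (fun e he => hv e (Finset.mem_insert_of_mem he))
    suffices h : ∃ r : R, 0 < r ∧ ∀ s : R, 0 < s → s ≤ r → e.2 ≤ e.1 ⬝ᵥ (x + s • v) by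
      obtain ⟨r, hr, he⟩ := h
      refine ⟨min t r, lt_min ht hr, fun s hs hst f hf => ?_⟩
      rcases Finset.mem_insert.1 hf with rfl | hf
      · exact he s hs (hst.trans (min_le_right _ _))
      · exact hB s hs (hst.trans (min_le_left _ _)) f hf
    have hxe := hx e (Finset.mem_insert_self _ _)
    have hve := hv e (Finset.mem_insert_self _ _)
    simp only [dotProduct_add, dotProduct_smul, smul_eq_mul]
    by_cases h0 : 0 ≤ e.1 ⬝ᵥ v
    · exact ⟨1, one_pos, fun s hs _ => hxe.trans (le_add_of_nonneg_right (mul_nonneg hs.le h0))⟩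
    · have hlt : e.2 < e.1 ⬝ᵥ x := lt_of_le_of_ne hxe fun h => h0 (hve h.symm)
      have hneg : 0 < -(e.1 ⬝ᵥ v) := by linarith [not_le.1 h0]
      refine ⟨(e.1 ⬝ᵥ x - e.2) / -(e.1 ⬝ᵥ v), div_pos (by linarith) hneg, fun s _ hsr => ?_⟩
      rw [le_div_iff₀ hneg] at hsr
      linarith

/-- A nonempty convex set satisfying finitely many inequalities has a point at which only those
inequalities are tight that are tight on the whole set. -/
theorem exists_mem_forall_tight (S : Set (Fin n → R)) (hS : Convex R S) (hne : S.Nonempty)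
    (base : Finset ((Fin n → R) × R)) (hle : ∀ e ∈ base, ∀ x ∈ S, e.2 ≤ e.1 ⬝ᵥ x) :
    ∃ x₀ ∈ S, ∀ e ∈ base, e.1 ⬝ᵥ x₀ = e.2 → ∀ x ∈ S, e.1 ⬝ᵥ x = e.2 := by
  classical
  induction base using Finset.induction_on with
  | empty =>
    obtain ⟨x, hx⟩ := hne
    exact ⟨x, hx, by simp⟩
  | insert e B _ ih =>
    obtain ⟨x, hx, hB⟩ := ih fun f hf => hle f (Finset.mem_insert_of_mem hf)
    by_cases h : ∀ y ∈ S, e.1 ⬝ᵥ y = e.2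
    · refine ⟨x, hx, fun f hf hfx => ?_⟩
      rcases Finset.mem_insert.1 hf with rfl | hf
      · exact h
      · exact hB f hf hfx
    · push Not at h
      obtain ⟨y, hy, hne⟩ := h
      -- Valid inequalities tight at a midpoint are tight at both ends.
      have hmid : (2⁻¹ : R) • x + (2⁻¹ : R) • y ∈ S :=
        hS hx hy (by positivity) (by positivity) (by norm_num)
      refine ⟨_, hmid, fun f hf hfx => ?_⟩
      have hfle := hle f hf
      have hxf := hfle x hx
      have hyf := hfle y hy
      simp only [dotProduct_add, dotProduct_smul, smul_eq_mul] at hfx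
      rcases Finset.mem_insert.1 hf with rfl | hf
      · exact absurd (by linarith) hne
      · exact hB f hf (by linarith)

theorem convex_argmin {P : Set (Fin n → R)} (hP : Convex R P) (c : Fin n → R) :
    Convex R (argmin P c) := by
  intro x hx y hy s t hs ht hst
  refine ⟨hP hx.1 hy.1 hs ht hst, fun z hz => ?_⟩
  have h1 := mul_le_mul_of_nonneg_left (hx.2 z hz) hs
  have h2 := mul_le_mul_of_nonneg_left (hy.2 z hz) ht
  simp only [dotProduct_add, dotProduct_smul, smul_eq_mul]
  calc _ ≤ s * (c ⬝ᵥ z) + t * (c ⬝ᵥ z) := add_le_add h1 h2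
    _ = c ⬝ᵥ z := by rw [← add_mul, hst, one_mul]

theorem convex_setOf_forall_le (base : Finset ((Fin n → R) × R)) :
    Convex R {x : Fin n → R | ∀ e ∈ base, e.2 ≤ e.1 ⬝ᵥ x} := by
  intro x hx y hy s t hs ht hst e he
  have h1 := mul_le_mul_of_nonneg_left (hx e he) hs
  have h2 := mul_le_mul_of_nonneg_left (hy e he) ht
  simp only [dotProduct_add, dotProduct_smul, smul_eq_mul]
  calc e.2 = s * e.2 + t * e.2 := by rw [← add_mul, hst, one_mul]
    _ ≤ _ := add_le_add h1 h2

/-- Making some valid inequalities tight yields a face. -/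
theorem isFace_setOf_tight (P : Set (Fin n → R)) (K : Finset ((Fin n → R) × R))
    (hK : ∀ e ∈ K, ∀ x ∈ P, e.2 ≤ e.1 ⬝ᵥ x) :
    IsFace P {x | x ∈ P ∧ ∀ e ∈ K, e.1 ⬝ᵥ x = e.2} := by
  rcases Set.eq_empty_or_nonempty {x | x ∈ P ∧ ∀ e ∈ K, e.1 ⬝ᵥ x = e.2} with h | ⟨z, hzP, hz⟩
  · exact Or.inl h
  -- The summed functional is at least `∑ e.2` on `P`, with equality exactly when every summand is
  -- tight; `z` attains it.
  refine Or.inr ⟨∑ e ∈ K, e.1, Set.ext fun x => ⟨fun hx => ⟨hx.1, fun y hy => ?_⟩,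
    fun hx => ⟨hx.1, ?_⟩⟩⟩
  · simp only [sum_dotProduct]
    exact Finset.sum_le_sum fun e he => (hx.2 e he).le.trans (hK e he y hy)
  · have h := hx.2 z hzP
    simp only [sum_dotProduct] at h
    rw [Finset.sum_congr rfl hz] at h
    have h' := le_antisymm (Finset.sum_le_sum fun e he => hK e he x hx.1) h
    exact fun e he =>
      ((Finset.sum_eq_sum_iff_of_le fun e he => hK e he x hx.1).1 h' e he).symm

/-- A nonempty face of a polyhedron inside an affine subspace is obtained by making some of the
defining inequalities tight. -/
theorem exists_argmin_eq_setOf_tight (S : Set (Fin n → R)) (A : AffineSubspace R (Fin n → R))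
    (base : Finset ((Fin n → R) × R))
    (hS : S = {x | x ∈ A ∧ ∀ e ∈ base, e.2 ≤ e.1 ⬝ᵥ x}) (c : Fin n → R)
    (hne : (argmin S c).Nonempty) :
    ∃ K ⊆ base, argmin S c = {x | x ∈ S ∧ ∀ e ∈ K, e.1 ⬝ᵥ x = e.2} := by
  classical
  have hmem : ∀ x, x ∈ S ↔ x ∈ A ∧ ∀ e ∈ base, e.2 ≤ e.1 ⬝ᵥ x := fun x => by rw [hS]; rfl
  have hconv : Convex R S := by
    have : S = (A : Set (Fin n → R)) ∩ {x | ∀ e ∈ base, e.2 ≤ e.1 ⬝ᵥ x} := hS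
    rw [this]
    exact A.convex.inter (convex_setOf_forall_le base)
  obtain ⟨x₀, hx₀, htight⟩ := exists_mem_forall_tight _ (convex_argmin hconv c) hne base
    fun e he x hx => ((hmem x).1 hx.1).2 e he
  refine ⟨base.filter fun e => e.1 ⬝ᵥ x₀ = e.2, Finset.filter_subset _ _,
    Set.ext fun y => ⟨fun hy => ⟨hy.1, fun e he => ?_⟩, fun hy => ⟨hy.1, fun z hz => ?_⟩⟩⟩
  · rw [Finset.mem_filter] at he
    exact htight e he.1 he.2 y hy
  -- The segment from `y` to `x₀` extends slightly beyond `x₀` within `S`; minimality at `x₀` then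
  -- forces `c ⬝ᵥ y ≤ c ⬝ᵥ x₀`.
  · obtain ⟨t, ht, hmove⟩ := exists_pos_add_smul_mem base x₀ (x₀ - y) ((hmem x₀).1 hx₀.1).2
      fun e he hex => by
        rw [dotProduct_sub, hex, hy.2 e (Finset.mem_filter.2 ⟨he, hex⟩), sub_self]
    have hA : x₀ + t • (x₀ - y) ∈ A := by
      have := AffineMap.lineMap_mem (-t) ((hmem x₀).1 hx₀.1).1 ((hmem y).1 hy.1).1
      rw [AffineMap.lineMap_apply] at this
      convert this using 1
      simp only [vsub_eq_sub, vadd_eq_add]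
      module
    have h := hx₀.2 _ ((hmem _).2 ⟨hA, hmove⟩)
    simp only [dotProduct_add, dotProduct_smul, dotProduct_sub, smul_eq_mul] at h
    have h2 : 0 ≤ c ⬝ᵥ x₀ - c ⬝ᵥ y := nonneg_of_mul_nonneg_right (by linarith) ht
    linarith [hx₀.2 z hz]

theorem exists_isFace_eq_setOf_tight (base : Finset ((Fin n → R) × R)) (F : Set (Fin n → R))
    (hF : IsFace {x | ∀ e ∈ base, e.2 ≤ e.1 ⬝ᵥ x} F) (hne : F.Nonempty) :
    ∃ K ⊆ base, F = {x | (∀ e ∈ base, e.2 ≤ e.1 ⬝ᵥ x) ∧ ∀ e ∈ K, e.1 ⬝ᵥ x = e.2} := by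
  rcases hF with rfl | ⟨c, rfl⟩
  · simp at hne
  · exact exists_argmin_eq_setOf_tight _ ⊤ base (by simp) c hne

end OrderedField

/-! ### Stability of faces and polyhedra -/

/-- A face of `P` contained in a subset `S` of `P` is a face of `S`. -/
theorem IsFace.of_subset {P S F : Set (Fin n → R)} (hF : IsFace P F) (hFS : F ⊆ S) (hSP : S ⊆ P) :
    IsFace S F := by
  rcases hF with rfl | ⟨c, rfl⟩
  · exact Or.inl rfl
  rcases Set.eq_empty_or_nonempty (argmin P c) with h | ⟨z, hz⟩
  · exact Or.inl h
  · exact Or.inr ⟨c, Set.ext fun x => ⟨fun hx => ⟨hFS hx, fun y hy => hx.2 y (hSP hy)⟩,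
      fun hx => ⟨hSP hx.1, fun y hy => (hx.2 z (hFS hz)).trans (hz.2 y hy)⟩⟩⟩

theorem isPolyhedron_halfspace (α : Fin n → R) (β : R) :
    IsPolyhedron {x : Fin n → R | β ≤ α ⬝ᵥ x} :=
  ⟨{(α, β)}, by simp⟩

theorem isPolyhedron_le_linearMap (φ : (Fin n → R) →ₗ[R] R) (β : R) :
    IsPolyhedron {x : Fin n → R | β ≤ φ x} := by
  convert isPolyhedron_halfspace ((dotProductEquiv R (Fin n)).symm φ) β using 3 with x
  exact Iff.of_eq
    congr(β ≤ $(LinearMap.congr_fun ((dotProductEquiv R (Fin n)).apply_symm_apply φ) x)).symm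

theorem IsPolyhedron.inter {P S : Set (Fin n → R)} (hP : IsPolyhedron P) (hS : IsPolyhedron S) :
    IsPolyhedron (P ∩ S) := by
  classical
  obtain ⟨B, rfl⟩ := hP
  obtain ⟨B', rfl⟩ := hS
  refine ⟨B ∪ B', Set.ext fun x => ?_⟩
  simp only [Set.mem_inter_iff, Set.mem_ofPred_eq, Finset.mem_union, or_imp, forall_and]

theorem IsPolyhedron.iInter {ι : Type*} [Finite ι] {P : ι → Set (Fin n → R)}
    (hP : ∀ i, IsPolyhedron (P i)) : IsPolyhedron (⋂ i, P i) := by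
  classical
  have := Fintype.ofFinite ι
  choose B hB using hP
  refine ⟨Finset.univ.biUnion B, Set.ext fun x => ?_⟩
  simp only [hB, Set.mem_iInter, Set.mem_ofPred_eq, Finset.mem_biUnion, Finset.mem_univ, true_and]
  exact ⟨fun h e ⟨i, hi⟩ => h i e hi, fun h i e hi => h e ⟨i, hi⟩⟩

section OrderedField

variable [IsStrictOrderedRing R]

theorem isPolyhedron_hyperplane (α : Fin n → R) (β : R) :
    IsPolyhedron {x : Fin n → R | α ⬝ᵥ x = β} := by
  convert (isPolyhedron_halfspace α β).inter (isPolyhedron_halfspace (-α) (-β)) using 1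
  ext x
  simp only [Set.mem_ofPred_eq, Set.mem_inter_iff, neg_dotProduct, neg_le_neg_iff]
  exact ⟨fun h => ⟨h.ge, h.le⟩, fun h => le_antisymm h.2 h.1⟩

theorem isPolyhedron_linearMap_eq (φ : (Fin n → R) →ₗ[R] R) (β : R) :
    IsPolyhedron {x : Fin n → R | φ x = β} := by
  convert isPolyhedron_hyperplane ((dotProductEquiv R (Fin n)).symm φ) β using 3 with x
  exact Iff.of_eq
    congr($(LinearMap.congr_fun ((dotProductEquiv R (Fin n)).apply_symm_apply φ) x) = β).symm

theorem isPolyhedron_empty : IsPolyhedron (∅ : Set (Fin n → R)) :=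
  ⟨{(0, 1)}, by simp [Set.ext_iff]⟩

theorem IsFace.isPolyhedron {P F : Set (Fin n → R)} (hP : IsPolyhedron P) (hF : IsFace P F) :
    IsPolyhedron F := by
  rcases Set.eq_empty_or_nonempty F with rfl | hne
  · exact isPolyhedron_empty
  obtain ⟨B, rfl⟩ := hP
  obtain ⟨K, -, rfl⟩ := exists_isFace_eq_setOf_tight B F hF hne
  convert IsPolyhedron.inter ⟨B, rfl⟩
    (IsPolyhedron.iInter fun e : K => isPolyhedron_hyperplane e.1.1 e.1.2) using 1
  ext x
  simp

theorem IsFace.isPolytope {P F : Set (Fin n → R)} (hP : IsPolytope P) (hF : IsFace P F) :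
    IsPolytope F := by
  obtain ⟨hP, M, hM⟩ := hP
  exact ⟨hF.isPolyhedron hP, M, fun x hx => hM x (hF.subset hx)⟩

/-- A face of a face of a polyhedron is a face. -/
theorem IsFace.trans {P Q F : Set (Fin n → R)} (hP : IsPolyhedron P) (hQ : IsFace P Q)
    (hF : IsFace Q F) : IsFace P F := by
  classical
  rcases Set.eq_empty_or_nonempty F with rfl | hne
  · exact Or.inl rfl
  obtain ⟨B, rfl⟩ := hP
  obtain ⟨K, hKB, hQ'⟩ := exists_isFace_eq_setOf_tight B Q hQ (hne.mono hF.subset)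
  let A : AffineSubspace R (Fin n → R) :=
    { carrier := {x | ∀ e ∈ K, e.1 ⬝ᵥ x = e.2}
      smul_vsub_vadd_mem' := fun t x y z hx hy hz e he => by
        simp [hx e he, hy e he, hz e he] }
  rcases hF with rfl | ⟨c, rfl⟩
  · exact Or.inl rfl
  obtain ⟨L, hLB, hL⟩ := exists_argmin_eq_setOf_tight Q A B
    (by rw [hQ']; ext x; exact and_comm) c hne
  convert isFace_setOf_tight {x | ∀ e ∈ B, e.2 ≤ e.1 ⬝ᵥ x} (K ∪ L) fun e he x hx =>
    hx e (Finset.union_subset hKB hLB he) using 1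
  rw [hL, hQ']
  ext x
  simp only [Set.mem_ofPred_eq, Finset.mem_union, or_imp, forall_and, and_assoc]

end OrderedField

/-! ### The base of a polyhedral cone -/

section ConeBase

/-- Makes `g ∘ a` a projection with kernel `ker a`, so its fixed points form a complement of the
lineality space. -/
theorem exists_generalizedInverse {K V W : Type*} [Field K] [AddCommGroup V] [Module K V]
    [AddCommGroup W] [Module K W] (a : V →ₗ[K] W) :
    ∃ g : W →ₗ[K] V, ∀ v, a (g (a v)) = a v := by
  obtain ⟨s, hs⟩ := a.rangeRestrict.exists_rightInverse_of_surjective a.range_rangeRestrict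
  obtain ⟨g, hg⟩ := s.exists_extend
  refine ⟨g, fun v => ?_⟩
  have h1 : g (a v) = s (a.rangeRestrict v) := LinearMap.congr_fun hg (a.rangeRestrict v)
  rw [h1]
  exact congrArg Subtype.val (LinearMap.congr_fun hs (a.rangeRestrict v))

/-- If a linear functional is constant `1` on a nonempty set, then the linear span of the set
has dimension one more than its affine span. -/
theorem finrank_vectorSpan_add_one {K V : Type*} [Field K] [AddCommGroup V] [Module K V]
    [FiniteDimensional K V] {S : Set V} (hne : S.Nonempty) (φ : V →ₗ[K] K)
    (hφ : ∀ v ∈ S, φ v = 1) :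
    Module.finrank K (vectorSpan K S) + 1 = Module.finrank K (Submodule.span K S) := by
  obtain ⟨w, hw⟩ := hne
  have hw0 : w ≠ 0 := by
    rintro rfl
    simpa using hφ 0 hw
  have hker : vectorSpan K S ≤ LinearMap.ker φ := by
    rw [vectorSpan_def, Submodule.span_le]
    rintro _ ⟨x, hx, y, hy, rfl⟩
    simp [hφ x hx, hφ y hy]
  have hsup : vectorSpan K S ⊔ K ∙ w = Submodule.span K S := by
    apply le_antisymm
    · refine sup_le ?_ (Submodule.span_mono (Set.singleton_subset_iff.2 hw))
      rw [vectorSpan_def, Submodule.span_le]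
      rintro _ ⟨x, hx, y, hy, rfl⟩
      exact Submodule.sub_mem _ (Submodule.subset_span hx) (Submodule.subset_span hy)
    · rw [Submodule.span_le]
      intro x hx
      rw [← sub_add_cancel x w]
      exact Submodule.add_mem_sup (vsub_mem_vectorSpan K hx hw)
        (Submodule.mem_span_singleton_self w)
  have hinf : vectorSpan K S ⊓ K ∙ w = ⊥ := by
    rw [Submodule.eq_bot_iff]
    rintro x ⟨hx, hxw⟩
    obtain ⟨t, rfl⟩ := Submodule.mem_span_singleton.1 hxw
    have h := hker hx
    rw [LinearMap.mem_ker, map_smul, hφ w hw, smul_eq_mul, mul_one] at h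
    rw [h, zero_smul]
  have h := Submodule.finrank_sup_add_finrank_inf_eq (vectorSpan K S) (K ∙ w)
  rw [hsup, hinf, finrank_bot, add_zero, finrank_span_singleton hw0] at h
  exact h.symm

theorem polyDim_of_nonempty {K : Type*} [Field K] {P : Set (Fin n → K)} (hP : P.Nonempty) :
    polyDim P = Module.finrank K (vectorSpan K P) + 1 := by
  rw [polyDim, if_neg hP.ne_empty, direction_affineSpan]

theorem vectorSpan_eq_span_of_cone {S C : Set (Fin n → R)} {x₀ : Fin n → R} (hx₀ : x₀ ∈ S)
    (h1 : ∀ x ∈ S, x - x₀ ∈ C) (h2 : ∀ v ∈ C, ∃ t : R, 0 < t ∧ x₀ + t • v ∈ S) :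
    vectorSpan R S = Submodule.span R C := by
  rw [vectorSpan_eq_span_vsub_set_right R hx₀]
  apply le_antisymm <;> rw [Submodule.span_le]
  · rintro _ ⟨x, hx, rfl⟩
    exact Submodule.subset_span (h1 x hx)
  · intro v hv
    obtain ⟨t, ht, hmem⟩ := h2 v hv
    have h : t • v ∈ Submodule.span R ((· -ᵥ x₀) '' S) :=
      Submodule.subset_span ⟨_, hmem, by simp⟩
    simpa [smul_smul, inv_mul_cancel₀ ht.ne'] using Submodule.smul_mem _ t⁻¹ h

/-- The base of the cone `{v | 0 ≤ a v}`: the points whose coordinates `a v` sum to `1` in the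
complement of the lineality space `ker a` cut out by a generalized inverse `g` of `a`. -/
def coneBase {ι : Type*} [Fintype ι] (a : (Fin n → R) →ₗ[R] (ι → R))
    (g : (ι → R) →ₗ[R] (Fin n → R)) : Set (Fin n → R) :=
  {v | (∀ j, 0 ≤ a v j) ∧ ∑ j, a v j = 1 ∧ g (a v) = v}

variable {ι : Type*} [Fintype ι] (a : (Fin n → R) →ₗ[R] (ι → R))
  (g : (ι → R) →ₗ[R] (Fin n → R))

/-- The base lies in an affine hyperplane missing the origin, so the shifted dimension is the linear
one, also when the base is empty. -/
theorem polyDim_coneBase :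
    polyDim (coneBase a g) = Module.finrank R (Submodule.span R (coneBase a g)) := by
  rcases Set.eq_empty_or_nonempty (coneBase a g) with h | h
  · rw [h, Submodule.span_empty, finrank_bot, polyDim, if_pos rfl]
  · rw [polyDim_of_nonempty h]
    exact finrank_vectorSpan_add_one h (∑ j, LinearMap.proj j ∘ₗ a) fun v hv => by
      simpa using hv.2.1

variable [IsStrictOrderedRing R]

theorem isPolytope_coneBase : IsPolytope (coneBase a g) := by
  classical
  constructor
  · have h1 := IsPolyhedron.iInter fun j => isPolyhedron_le_linearMap (LinearMap.proj j ∘ₗ a) 0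
    have h2 := isPolyhedron_linearMap_eq (∑ j, LinearMap.proj j ∘ₗ a) 1
    have h3 := IsPolyhedron.iInter fun i =>
      isPolyhedron_linearMap_eq (LinearMap.proj i ∘ₗ (g ∘ₗ a - LinearMap.id)) 0
    convert h1.inter (h2.inter h3) using 1
    ext v
    simp [coneBase, sub_eq_zero, funext_iff]
  -- The coordinates of `a v` lie in `[0, 1]` and `v = g (a v)`, so the entries of `g` bound `v`.
  · refine ⟨∑ i, ∑ j, |LinearMap.toMatrix' g i j|, fun v ⟨h0, h1, hv⟩ i => ?_⟩
    have hle : ∀ j, |a v j| ≤ 1 := fun j => by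
      rw [abs_of_nonneg (h0 j), ← h1]
      exact Finset.single_le_sum (fun j _ => h0 j) (Finset.mem_univ j)
    have hvi : v i = ∑ j, a v j * LinearMap.toMatrix' g i j := by
      conv_lhs => rw [← hv, ← LinearMap.toMatrix'_mulVec]
      exact Finset.sum_congr rfl fun j _ => mul_comm _ _
    calc |v i| ≤ ∑ j, |a v j * LinearMap.toMatrix' g i j| := by
          rw [hvi]
          exact Finset.abs_sum_le_sum_abs _ _
      _ ≤ ∑ j, |LinearMap.toMatrix' g i j| := Finset.sum_le_sum fun j _ => by
          rw [abs_mul]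
          exact mul_le_of_le_one_left (abs_nonneg _) (hle j)
      _ ≤ _ := Finset.single_le_sum (f := fun i => ∑ j, |LinearMap.toMatrix' g i j|)
          (fun i _ => Finset.sum_nonneg fun j _ => abs_nonneg _) (Finset.mem_univ i)

variable {a g}

theorem smul_mem_coneBase (hag : ∀ v, a (g (a v)) = a v) {v : Fin n → R} (hv : ∀ j, 0 ≤ a v j)
    (hpos : 0 < ∑ j, a v j) : (∑ j, a v j)⁻¹ • g (a v) ∈ coneBase a g := by
  refine ⟨fun j => ?_, ?_, ?_⟩
  · rw [map_smul, hag]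
    exact mul_nonneg (inv_nonneg.2 hpos.le) (hv j)
  · simp only [map_smul, hag, Pi.smul_apply, smul_eq_mul, ← Finset.mul_sum]
    exact inv_mul_cancel₀ hpos.ne'
  · simp only [map_smul, hag]

/-- Rank-nullity for `a` on the span `D` of the cone: `D` contains `ker a`, and `a` maps `D` onto
the image of the span of the base, on which `g` inverts `a`. -/
theorem finrank_span_cone (hag : ∀ v, a (g (a v)) = a v) :
    Module.finrank R (Submodule.span R {v | ∀ j, 0 ≤ a v j}) =
      polyDim (coneBase a g) + Module.finrank R (LinearMap.ker a) := by
  set D := Submodule.span R {v | ∀ j, 0 ≤ a v j} with hD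
  set S := Submodule.span R (coneBase a g) with hS
  have hmap : D.map a = S.map a := by
    apply le_antisymm
    · rw [hD, Submodule.map_span_le]
      intro v hv
      rcases (Finset.sum_nonneg fun j _ => hv j : 0 ≤ ∑ j, a v j).eq_or_lt with h | h
      · have : a v = 0 := funext fun j =>
          (Finset.sum_eq_zero_iff_of_nonneg fun j _ => hv j).1 h.symm j (Finset.mem_univ j)
        rw [this]
        exact Submodule.zero_mem _
      · have hm := Submodule.smul_mem _ (∑ j, a v j)
          (Submodule.mem_map_of_mem (f := a) (Submodule.subset_span (smul_mem_coneBase hag hv h)))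
        rwa [map_smul, hag, smul_smul, mul_inv_cancel₀ h.ne', one_smul] at hm
    · exact Submodule.map_mono (Submodule.span_mono fun v hv => hv.1)
  have hback : (S.map a).map g = S := by
    rw [← Submodule.map_comp, hS, Submodule.map_span]
    congr 1
    ext v
    constructor
    · rintro ⟨w, hw, rfl⟩
      rw [LinearMap.comp_apply, hw.2.2]
      exact hw
    · exact fun hv => ⟨v, hv, hv.2.2⟩
  have hrank : Module.finrank R (S.map a) = Module.finrank R S := by
    apply le_antisymm (Submodule.finrank_map_le a S)
    conv_lhs => rw [← hback]
    exact Submodule.finrank_map_le g _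
  have hker : LinearMap.ker a ≤ D := fun v hv => Submodule.subset_span fun j => by
    rw [LinearMap.mem_ker.1 hv]
    rfl
  have h := LinearMap.finrank_range_add_finrank_ker (a.domRestrict D)
  rw [LinearMap.range_domRestrict, LinearMap.ker_domRestrict, hmap, hrank] at h
  rw [polyDim_coneBase, ← hS, ← h]
  congr 1
  exact (Submodule.comapSubtypeEquivOfLe hker).finrank_eq

end ConeBase

/-! ### Feasible directions at a point of a face -/

open Classical in
/-- The inequalities among `B` that are tight at `x₀`. -/
noncomputable def tight (B : Finset ((Fin n → R) × R)) (x₀ : Fin n → R) :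
    Finset ((Fin n → R) × R) :=
  B.filter fun e => e.1 ⬝ᵥ x₀ = e.2

theorem mem_tight {B : Finset ((Fin n → R) × R)} {x₀ : Fin n → R} {e : (Fin n → R) × R} :
    e ∈ tight B x₀ ↔ e ∈ B ∧ e.1 ⬝ᵥ x₀ = e.2 := by
  classical
  exact Finset.mem_filter

/-- The linear parts of the inequalities among `B` that are tight at `x₀`. -/
noncomputable def tightMap (B : Finset ((Fin n → R) × R)) (x₀ : Fin n → R) :
    (Fin n → R) →ₗ[R] (tight B x₀ → R) :=
  Matrix.mulVecLin (Matrix.of fun e : tight B x₀ => e.1.1)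

theorem tightMap_apply (B : Finset ((Fin n → R) × R)) (x₀ v : Fin n → R) (e : tight B x₀) :
    tightMap B x₀ v e = e.1.1 ⬝ᵥ v := rfl

/-- The points of the base of the cone of feasible directions at `x₀` that point into `F`. -/
def faceFigure (B : Finset ((Fin n → R) × R)) (x₀ : Fin n → R)
    (g : (tight B x₀ → R) →ₗ[R] (Fin n → R)) (F : Set (Fin n → R)) : Set (Fin n → R) :=
  {v | v ∈ coneBase (tightMap B x₀) g ∧ ∃ t : R, 0 < t ∧ x₀ + t • v ∈ F}

theorem faceFigure_mono {B : Finset ((Fin n → R) × R)} {x₀ : Fin n → R}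
    {g : (tight B x₀ → R) →ₗ[R] (Fin n → R)} {F G : Set (Fin n → R)} (h : F ⊆ G) :
    faceFigure B x₀ g F ⊆ faceFigure B x₀ g G :=
  fun _ ⟨hv, t, ht, hF⟩ => ⟨hv, t, ht, h hF⟩

theorem sub_mem_cone {B : Finset ((Fin n → R) × R)} {x₀ x : Fin n → R} [IsStrictOrderedRing R]
    (hx : ∀ e ∈ B, e.2 ≤ e.1 ⬝ᵥ x) (j : tight B x₀) : 0 ≤ tightMap B x₀ (x - x₀) j := by
  obtain ⟨hB, h⟩ := mem_tight.1 j.2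
  rw [tightMap_apply, dotProduct_sub, h, sub_nonneg]
  exact hx _ hB

variable [IsStrictOrderedRing R] {B : Finset ((Fin n → R) × R)} {x₀ : Fin n → R}
  {g : (tight B x₀ → R) →ₗ[R] (Fin n → R)}

/-- The dictionary between both sides: at `x₀`, an affine equation from a tight inequality becomes
homogeneous in the direction. -/
theorem faceFigure_setOf_tight (hx₀ : ∀ e ∈ B, e.2 ≤ e.1 ⬝ᵥ x₀)
    {K : Finset ((Fin n → R) × R)} (hK : K ⊆ tight B x₀) :
    faceFigure B x₀ g {x | (∀ e ∈ B, e.2 ≤ e.1 ⬝ᵥ x) ∧ ∀ e ∈ K, e.1 ⬝ᵥ x = e.2} =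
      {v | v ∈ coneBase (tightMap B x₀) g ∧ ∀ e ∈ K, e.1 ⬝ᵥ v = 0} := by
  ext v
  refine and_congr_right fun hv => ⟨fun ⟨t, ht, _, hm⟩ e he => ?_, fun h => ?_⟩
  · have h := hm e he
    rw [dotProduct_add, (mem_tight.1 (hK he)).2, dotProduct_smul, smul_eq_mul,
      add_eq_left] at h
    exact (mul_eq_zero.1 h).resolve_left ht.ne'
  · obtain ⟨t, ht, hm⟩ := exists_pos_add_smul_mem B x₀ v hx₀ fun e he hex =>
      hv.1 ⟨e, mem_tight.2 ⟨he, hex⟩⟩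
    refine ⟨t, ht, hm, fun e he => ?_⟩
    rw [dotProduct_add, (mem_tight.1 (hK he)).2, dotProduct_smul, h e he, smul_zero, add_zero]

/-- A face through `x₀` is obtained by making inequalities tight that are tight at `x₀`. -/
theorem exists_subset_tight {F : Set (Fin n → R)}
    (hF : IsFace {x | ∀ e ∈ B, e.2 ≤ e.1 ⬝ᵥ x} F) (hx₀F : x₀ ∈ F) :
    ∃ K ⊆ tight B x₀, F = {x | (∀ e ∈ B, e.2 ≤ e.1 ⬝ᵥ x) ∧ ∀ e ∈ K, e.1 ⬝ᵥ x = e.2} := by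
  obtain ⟨K, hK, hFK⟩ := exists_isFace_eq_setOf_tight B F hF ⟨x₀, hx₀F⟩
  refine ⟨K, fun e he => mem_tight.2 ⟨hK he, ?_⟩, hFK⟩
  rw [hFK] at hx₀F
  exact hx₀F.2 e he

theorem isFace_faceFigure {F : Set (Fin n → R)}
    (hF : IsFace {x | ∀ e ∈ B, e.2 ≤ e.1 ⬝ᵥ x} F) (hx₀F : x₀ ∈ F) :
    IsFace (coneBase (tightMap B x₀) g) (faceFigure B x₀ g F) := by
  classical
  obtain ⟨K, hK, hFK⟩ := exists_subset_tight hF hx₀F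
  rw [hFK, faceFigure_setOf_tight (hF.subset hx₀F) hK]
  convert isFace_setOf_tight (coneBase (tightMap B x₀) g) (K.image fun e => (e.1, 0)) ?_ using 1
  · ext v
    simp only [Set.mem_ofPred_eq, Finset.forall_mem_image]
  · rw [Finset.forall_mem_image]
    exact fun e he v hv => hv.1 ⟨e, hK he⟩

/-- For `x ∈ F`, the direction `x - x₀` either lies in `ker a`, making all inequalities in `tight B
x₀` tight at `x`, or normalizes into the base without changing which of them are tight. -/
theorem subset_of_faceFigure_subset
    (hg : ∀ v, tightMap B x₀ (g (tightMap B x₀ v)) = tightMap B x₀ v) {F G : Set (Fin n → R)}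
    (hF : IsFace {x | ∀ e ∈ B, e.2 ≤ e.1 ⬝ᵥ x} F) (hx₀F : x₀ ∈ F)
    (hG : IsFace {x | ∀ e ∈ B, e.2 ≤ e.1 ⬝ᵥ x} G) (hx₀G : x₀ ∈ G)
    (h : faceFigure B x₀ g F ⊆ faceFigure B x₀ g G) : F ⊆ G := by
  obtain ⟨K, hK, hFK⟩ := exists_subset_tight hF hx₀F
  obtain ⟨L, hL, hGL⟩ := exists_subset_tight hG hx₀G
  have hx₀ := hF.subset hx₀F
  rw [hFK, hGL, faceFigure_setOf_tight hx₀ hK, faceFigure_setOf_tight hx₀ hL] at h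
  rw [hFK, hGL]
  rintro x ⟨hxB, hxK⟩
  refine ⟨hxB, fun e he => ?_⟩
  have hcone := sub_mem_cone (x₀ := x₀) hxB
  have key : ∀ e ∈ tight B x₀, e.1 ⬝ᵥ (x - x₀) = 0 ↔ e.1 ⬝ᵥ x = e.2 := fun e he => by
    rw [dotProduct_sub, (mem_tight.1 he).2, sub_eq_zero]
  rw [← key e (hL he)]
  rcases (Finset.sum_nonneg fun j _ => hcone j :
    0 ≤ ∑ j, tightMap B x₀ (x - x₀) j).eq_or_lt with hs | hs
  · exact (Finset.sum_eq_zero_iff_of_nonneg fun j _ => hcone j).1 hs.symm ⟨e, hL he⟩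
      (Finset.mem_univ _)
  · set s := ∑ j, tightMap B x₀ (x - x₀) j
    set w := s⁻¹ • g (tightMap B x₀ (x - x₀)) with hw
    have hdot : ∀ e ∈ tight B x₀, e.1 ⬝ᵥ w = s⁻¹ * (e.1 ⬝ᵥ (x - x₀)) := fun e he => by
      rw [← tightMap_apply B x₀ w ⟨e, he⟩, hw, map_smul, hg]
      rfl
    have h1 := (h ⟨smul_mem_coneBase hg hcone hs, fun e he => by
      rw [hdot e (hK he), (key e (hK he)).2 (hxK e he), mul_zero]⟩).2 e he
    rw [hdot e (hL he)] at h1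
    exact (mul_eq_zero.1 h1).resolve_left (inv_ne_zero hs.ne')

theorem exists_faceFigure_eq (hx₀ : ∀ e ∈ B, e.2 ≤ e.1 ⬝ᵥ x₀) {G : Set (Fin n → R)}
    (hG : IsFace (coneBase (tightMap B x₀) g) G) :
    ∃ K ⊆ tight B x₀, faceFigure B x₀ g
      {x | (∀ e ∈ B, e.2 ≤ e.1 ⬝ᵥ x) ∧ ∀ e ∈ K, e.1 ⬝ᵥ x = e.2} = G := by
  classical
  suffices h : ∃ K ⊆ tight B x₀,
      {v | v ∈ coneBase (tightMap B x₀) g ∧ ∀ e ∈ K, e.1 ⬝ᵥ v = 0} = G by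
    obtain ⟨K, hK, h⟩ := h
    exact ⟨K, hK, (faceFigure_setOf_tight hx₀ hK).trans h⟩
  rcases Set.eq_empty_or_nonempty G with rfl | hne
  -- Making everything in `tight B x₀` tight gives `a v = 0`, against coordinate sum `1`.
  · refine ⟨_, subset_rfl, Set.eq_empty_of_forall_notMem fun v ⟨hv, h⟩ => ?_⟩
    have h1 := hv.2.1
    rw [Finset.sum_eq_zero fun j _ => h j.1 j.2] at h1
    exact zero_ne_one h1
  rcases hG with rfl | ⟨c, rfl⟩
  · simp at hne
  -- The slice equations go into `A`, leaving only the inequalities `0 ≤ a v` to be made tight.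
  let A : AffineSubspace R (Fin n → R) :=
    { carrier := {v | ∑ j, tightMap B x₀ v j = 1 ∧ g (tightMap B x₀ v) = v}
      smul_vsub_vadd_mem' := fun t x y z hx hy hz => by
        refine ⟨?_, ?_⟩
        · simp [Finset.sum_add_distrib, ← Finset.mul_sum, hx.1, hy.1, hz.1, -Finset.univ_eq_attach]
        · simp [hx.2, hy.2, hz.2] }
  obtain ⟨L, hL, hGL⟩ := exists_argmin_eq_setOf_tight (coneBase (tightMap B x₀) g) A
    ((tight B x₀).image fun e => (e.1, 0))
    (by
      ext v
      simp only [Set.mem_ofPred_eq, Finset.forall_mem_image]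
      exact ⟨fun h => ⟨h.2, fun e he => h.1 ⟨e, he⟩⟩, fun h => ⟨fun j => h.2 j.2, h.1⟩⟩) c hne
  obtain ⟨K, hK, rfl⟩ := Finset.subset_image_iff.1 hL
  refine ⟨K, hK, ?_⟩
  rw [hGL]
  ext v
  simp only [Set.mem_ofPred_eq, Finset.forall_mem_image]

/-- The faces of a polyhedron that contain the face `Q` form the face lattice of the base of the
cone of feasible directions at a relative interior point `x₀` of `Q`. -/
theorem nonempty_orderIso_coneBase
    (hg : ∀ v, tightMap B x₀ (g (tightMap B x₀ v)) = tightMap B x₀ v)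
    (Q : FaceLattice {x : Fin n → R | ∀ e ∈ B, e.2 ≤ e.1 ⬝ᵥ x}) (hx₀Q : x₀ ∈ Q.1)
    (hQ : ∀ e ∈ tight B x₀, ∀ x ∈ Q.1, e.1 ⬝ᵥ x = e.2) :
    Nonempty (Set.Icc Q ⊤ ≃o FaceLattice (coneBase (tightMap B x₀) g)) := by
  have hmem : ∀ F : Set.Icc Q ⊤, x₀ ∈ F.1.1 := fun F => F.2.1 hx₀Q
  let f : Set.Icc Q ⊤ ↪o FaceLattice (coneBase (tightMap B x₀) g) :=
    OrderEmbedding.ofMapLEIff (fun F => ⟨faceFigure B x₀ g F.1.1, isFace_faceFigure F.1.2 (hmem F)⟩)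
      fun F G => ⟨subset_of_faceFigure_subset hg F.1.2 (hmem F) G.1.2 (hmem G),
        fun h => faceFigure_mono h⟩
  refine ⟨RelIso.ofSurjective f fun G => ?_⟩
  obtain ⟨K, hK, h⟩ := exists_faceFigure_eq (Q.2.subset hx₀Q) G.2
  have hface := isFace_setOf_tight {x : Fin n → R | ∀ e ∈ B, e.2 ≤ e.1 ⬝ᵥ x} K
    fun e he x hx => hx e (mem_tight.1 (hK he)).1
  exact ⟨⟨⟨_, hface⟩, fun x hx => ⟨Q.2.subset hx, fun e he => hQ e (hK he) x hx⟩, le_top⟩,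
    Subtype.ext h⟩

/-- The direction of `P` is the span of the cone and that of `Q` is `ker a`; the two shifts by one
cancel. -/
theorem polyDim_eq_coneBase_add
    (hg : ∀ v, tightMap B x₀ (g (tightMap B x₀ v)) = tightMap B x₀ v) {Q : Set (Fin n → R)}
    (hQ : IsFace {x | ∀ e ∈ B, e.2 ≤ e.1 ⬝ᵥ x} Q) (hx₀Q : x₀ ∈ Q)
    (htight : ∀ e ∈ tight B x₀, ∀ x ∈ Q, e.1 ⬝ᵥ x = e.2) :
    polyDim {x : Fin n → R | ∀ e ∈ B, e.2 ≤ e.1 ⬝ᵥ x} =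
      polyDim (coneBase (tightMap B x₀) g) + polyDim Q := by
  have hx₀ : ∀ e ∈ B, e.2 ≤ e.1 ⬝ᵥ x₀ := hQ.subset hx₀Q
  obtain ⟨K, hK, hQK⟩ := exists_subset_tight hQ hx₀Q
  have hmove : ∀ v, (∀ j, 0 ≤ tightMap B x₀ v j) →
      ∃ t : R, 0 < t ∧ ∀ e ∈ B, e.2 ≤ e.1 ⬝ᵥ (x₀ + t • v) := fun v hv =>
    exists_pos_add_smul_mem B x₀ v hx₀ fun e he hex => hv ⟨e, mem_tight.2 ⟨he, hex⟩⟩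
  have h1 : vectorSpan R {x : Fin n → R | ∀ e ∈ B, e.2 ≤ e.1 ⬝ᵥ x} =
      Submodule.span R {v | ∀ j, 0 ≤ tightMap B x₀ v j} :=
    vectorSpan_eq_span_of_cone hx₀ (fun x hx => sub_mem_cone hx) hmove
  have h2 : vectorSpan R Q = LinearMap.ker (tightMap B x₀) := by
    rw [← Submodule.span_eq (LinearMap.ker (tightMap B x₀))]
    refine vectorSpan_eq_span_of_cone hx₀Q (fun x hx => ?_) fun v hv => ?_
    · refine LinearMap.mem_ker.2 (funext fun j => ?_)
      rw [tightMap_apply, dotProduct_sub, htight _ j.2 x hx, htight _ j.2 x₀ hx₀Q, sub_self]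
      rfl
    · have hv0 : ∀ e ∈ tight B x₀, e.1 ⬝ᵥ v = 0 := fun e he =>
        congrFun (LinearMap.mem_ker.1 hv) ⟨e, he⟩
      obtain ⟨t, ht, hm⟩ := hmove v fun j => (hv0 j.1 j.2).ge
      refine ⟨t, ht, ?_⟩
      rw [hQK]
      refine ⟨hm, fun e he => ?_⟩
      rw [dotProduct_add, (mem_tight.1 (hK he)).2, dotProduct_smul, hv0 e (hK he), smul_zero,
        add_zero]
  rw [polyDim_of_nonempty ⟨x₀, hQ.subset hx₀Q⟩, polyDim_of_nonempty ⟨x₀, hx₀Q⟩, h1, h2,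
    finrank_span_cone hg, add_assoc]

/-! ### Upper intervals and general intervals -/

theorem exists_polytope_orderIso_Icc_top {P : Set (Fin n → R)} (hP : IsPolytope P)
    (Q : FaceLattice P) :
    ∃ P' : Set (Fin n → R), IsPolytope P' ∧ Nonempty (Set.Icc Q ⊤ ≃o FaceLattice P') ∧
      polyDim P = polyDim P' + Q.rank := by
  -- The empty face has no point `x₀`, but has rank `0`, so `P` itself serves.
  rcases Set.eq_empty_or_nonempty Q.1 with h | hne
  · obtain rfl : Q = ⊥ := Subtype.ext h
    refine ⟨P, hP, ⟨?_⟩, ?_⟩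
    · rw [Set.Icc_bot_top]
      exact OrderIso.Set.univ
    · rw [FaceLattice.rank, h, polyDim, polyDim, if_pos rfl, add_zero]
  · obtain ⟨B, rfl⟩ := hP.1
    have hconv : Convex R Q.1 := by
      rcases Q.2 with h | ⟨c, h⟩
      · exact absurd h hne.ne_empty
      · rw [h]
        exact convex_argmin (convex_setOf_forall_le B) c
    obtain ⟨x₀, hx₀, ht⟩ := exists_mem_forall_tight Q.1 hconv hne B
      fun e he x hx => Q.2.subset hx e he
    have ht' : ∀ e ∈ tight B x₀, ∀ x ∈ Q.1, e.1 ⬝ᵥ x = e.2 := fun e he =>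
      ht e (mem_tight.1 he).1 (mem_tight.1 he).2
    obtain ⟨g, hg⟩ := exists_generalizedInverse (tightMap B x₀)
    exact ⟨_, isPolytope_coneBase _ g, nonempty_orderIso_coneBase hg Q hx₀ ht',
      polyDim_eq_coneBase_add hg Q.2 hx₀ ht'⟩

/-- The interval below a face `Q'` of a polyhedron is an interval of the face lattice of `Q'`. -/
def iccOrderIsoIccTop {P : Set (Fin n → R)} (hP : IsPolyhedron P) (Q Q' : FaceLattice P)
    (h : Q ≤ Q') :
    Set.Icc Q Q' ≃o
      Set.Icc (⟨Q.1, Q.2.of_subset h Q'.2.subset⟩ : FaceLattice Q'.1) ⊤ where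
  toFun F := ⟨⟨F.1.1, F.1.2.of_subset F.2.2 Q'.2.subset⟩, F.2.1, le_top⟩
  invFun F := ⟨⟨F.1.1, Q'.2.trans hP F.1.2⟩, F.2.1, F.1.2.subset⟩
  left_inv _ := rfl
  right_inv _ := rfl
  map_rel_iff' := Iff.rfl

end PolyhedralFaces

theorem mainTheorem2 {R : Type*} [Field R] [LinearOrder R] [IsStrictOrderedRing R] {n : ℕ}
    (P : Set (Fin n → R)) (hP : PolyhedralFaces.IsPolytope P) :
    (∀ Q : PolyhedralFaces.FaceLattice P,
      ∃ P' : Set (Fin n → R), PolyhedralFaces.IsPolytope P' ∧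
        Nonempty (Set.Icc Q ⊤ ≃o PolyhedralFaces.FaceLattice P') ∧
        PolyhedralFaces.polyDim P = PolyhedralFaces.polyDim P' + Q.rank) ∧
    (∀ Q Q' : PolyhedralFaces.FaceLattice P, Q ≤ Q' →
      ∃ P' : Set (Fin n → R), PolyhedralFaces.IsPolytope P' ∧
        Nonempty (Set.Icc Q Q' ≃o PolyhedralFaces.FaceLattice P') ∧
        Q'.rank = PolyhedralFaces.polyDim P' + Q.rank) := by
  refine ⟨PolyhedralFaces.exists_polytope_orderIso_Icc_top hP, fun Q Q' h => ?_⟩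
  obtain ⟨P', hP', ⟨f⟩, hdim⟩ := PolyhedralFaces.exists_polytope_orderIso_Icc_top
    (Q'.2.isPolytope hP) ⟨Q.1, Q.2.of_subset h Q'.2.subset⟩
  exact ⟨P', hP', ⟨(PolyhedralFaces.iccOrderIsoIccTop hP.1 Q Q' h).trans f⟩, hdim⟩
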